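/- Let $N=2d$ be even, $J=\begin{pmatrix}0&I\\-I&0\end{pmatrix}$ with $d\times d$ blocks, and for a vector field $f$ on $\mathbb R^N$ let $\phi_{t,f}(x)$ be the exact solution at (small) time $t$ of $\dot y=f(y)$, $y(0)=x$. A (one-step) numerical integrator $\Phi$ assigns to every step size $h$, vector field $f$ and initial value $x\in\mathbb R^N$ a numerical solution $\Phi_{h,f}(x)\in\mathbb R^N$. It is assumed to depend smoothly on $h$ and $x$ around $h=0$ for every smooth $f$, and, when $f$ itself depends smoothly on finitely many real parameters, jointly smoothly on these as well. It is consistent if it has some order $p\ge 1$, i.e. $\Phi_{h,f}(x)=\phi_{h,f}(x)+O(h^{p+1})$ as $h\to0$ for all smooth $f$ and all $x$. It is symplectic if for every smooth Hamiltonian $H:\mathbb R^N\to\mathbb R$ the maps $g=\Phi_{h,J^{-1}\nabla H}$ are, locally in $x$ and for all sufficiently small $h$, differentiable with $g'(x)^TJg'(x)=J$. The inverse modified differential equation (IMDE) of $\Phi$ for $\dot y=f(y)$ is the formal equation $\dot{\tilde y}=\sum_{k\ge0}h^kf_k(\tilde y)$, with smooth $h$-independent functions $f_k:\mathbb R^N\to\mathbb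 R^N$, such that $\Phi_{h,f_h}(x)=\phi_{h,f}(x)$ as formal power series in $h$; that is, for every $K\ge0$ and every $x$, $$\Phi_{h,f_h^K}(x)=\phi_{h,f}(x)+O(h^{K+2})\quad(h\to0),\qquad f_h^K=\sum_{k=0}^Kh^kf_k .$$ **Theorem.** Let $H:\mathbb R^N\to\mathbb R$ be smooth and let $\Phi$ be a consistent symplectic integrator. Then the IMDE $\sum_{k\ge0}h^kf_k$ of $\Phi$ for the Hamiltonian system $\dot y=J^{-1}\nabla H(y)$ is also a Hamiltonian system: every point of $\mathbb R^N$ has an open neighbourhood $U$ on which there exist smooth functions $H_k:U\to\mathbb R$, $k=0,1,2,\dots$, such that $$f_k(y)=J^{-1}\nabla H_k(y)\qquad\text{for all }y\in U\text{ and all }k\ge 0.$$ -/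

import Mathlib

open Filter Asymptotics
open scoped Topology ContDiff Matrix

/-- `y` is a solution, on some time interval around `0`, of the initial value problem
`y' = f(y)`, `y(0) = x`; that is, `y(t)` is the exact flow `φ_{t,f}(x)` for small `t`. -/
def IsSolution {E : Type*} [NormedAddCommGroup E] [NormedSpace ℝ E]
    (f : E → E) (x : E) (y : ℝ → E) : Prop :=
  y 0 = x ∧ ∀ᶠ t in 𝓝 (0 : ℝ), HasDerivAt y (f (y t)) t

/-- A (one-step) numerical integrator on the space `E`: to a step size `h`, a vector field `f` and
an initial value `x` it assigns the numerical solution `Φ_{h,f}(x)` after one step.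

Only its values for small `h` matter (an implicit method is given by the local solution of its
defining equations, and by an arbitrary value where there is none).  The numerical solution is a
smooth function of the step size and of the initial value around every `(0, x)`, also when the
vector field depends smoothly on finitely many real parameters `p`, and then jointly with them.
Its Taylor expansion in `h` is the formal expansion `Φ_{h,f}(x) = x + h d_{1,f}(x) + ⋯`
(the first term being `x` by consistency, see below). -/
structure Integrator (E : Type*) [NormedAddCommGroup E] [NormedSpace ℝ E] where
  /-- `step h f x` is `Φ_{h,f}(x)`. -/
  step : ℝ → (E → E) → E → E
  smooth : ∀ (m : ℕ) (F : EuclideanSpace ℝ (Fin m) → E → E),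
    ContDiff ℝ ∞ (fun q : EuclideanSpace ℝ (Fin m) × E => F q.1 q.2) →
    ∀ (p : EuclideanSpace ℝ (Fin m)) (x : E),
      ContDiffAt ℝ ∞
        (fun q : ℝ × EuclideanSpace ℝ (Fin m) × E => step q.1 (F q.2.1) q.2.2) (0, p, x)

/-- The integrator has order `p`: `Φ_{h,f}(x) = φ_{h,f}(x) + O(h^{p+1})` for every smooth vector
field `f` and every initial value `x`. -/
def Integrator.HasOrder {E : Type*} [NormedAddCommGroup E] [NormedSpace ℝ E]
    (Φ : Integrator E) (p : ℕ) : Prop :=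
  ∀ f : E → E, ContDiff ℝ ∞ f → ∀ (x : E) (y : ℝ → E), IsSolution f x y →
    (fun h : ℝ => Φ.step h f x - y h) =O[𝓝 0] (fun h : ℝ => h ^ (p + 1))

/-- The integrator is consistent: it has some order `p ≥ 1`. -/
def Integrator.IsConsistent {E : Type*} [NormedAddCommGroup E] [NormedSpace ℝ E]
    (Φ : Integrator E) : Prop :=
  ∃ p : ℕ, 1 ≤ p ∧ Φ.HasOrder p

/-- The truncation `f_h^K = ∑_{k=0}^K h^k f_k` of the formal vector field `∑ h^k f_k`. -/
def truncatedField {E : Type*} [NormedAddCommGroup E] [NormedSpace ℝ E]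
    (fk : ℕ → E → E) (K : ℕ) (h : ℝ) : E → E :=
  fun y => ∑ k ∈ Finset.range (K + 1), h ^ k • fk k y

/-- The formal vector field `∑ h^k f_k`, with smooth `h`-independent coefficients `f_k`, is the
inverse modified differential equation of the integrator `Φ` for the equation `y' = f(y)`:
`Φ_{h,f_h}(x) = φ_{h,f}(x)` as formal power series in `h`, that is,
`Φ_{h,f_h^K}(x) = φ_{h,f}(x) + O(h^{K+2})` for every truncation index `K` and every `x`. -/
structure IsIMDE {E : Type*} [NormedAddCommGroup E] [NormedSpace ℝ E]
    (Φ : Integrator E) (f : E → E) (fk : ℕ → E → E) : Prop where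
  smooth : ∀ k, ContDiff ℝ ∞ (fk k)
  expansion : ∀ (K : ℕ) (x : E) (y : ℝ → E), IsSolution f x y →
    (fun h : ℝ => Φ.step h (truncatedField fk K h) x - y h) =O[𝓝 0]
      (fun h : ℝ => h ^ (K + 2))

/-- The phase space `ℝ^N`, `N = 2d`, with the Euclidean norm; the coordinates are split into two
blocks of `d` coordinates. -/
abbrev PhaseSpace (d : ℕ) : Type := EuclideanSpace ℝ (Fin d ⊕ Fin d)

/-- The matrix `J = (0, I; -I, 0)`. -/
def structureMatrix (d : ℕ) : Matrix (Fin d ⊕ Fin d) (Fin d ⊕ Fin d) ℝ :=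
  Matrix.fromBlocks 0 1 (-1) 0

/-- The Hamiltonian vector field `J⁻¹ ∇H`. -/
noncomputable def hamiltonianField {d : ℕ} (H : PhaseSpace d → ℝ) : PhaseSpace d → PhaseSpace d :=
  fun y => WithLp.toLp 2 ((structureMatrix d)⁻¹ *ᵥ (gradient H y).ofLp)

/-- The Jacobian matrix `g'(x)`. -/
noncomputable def jacobianMatrix {d : ℕ} (g : PhaseSpace d → PhaseSpace d) (x : PhaseSpace d) :
    Matrix (Fin d ⊕ Fin d) (Fin d ⊕ Fin d) ℝ :=
  Matrix.of fun i j => (fderiv ℝ g x (EuclideanSpace.single j 1)).ofLp i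

/-- `g` is a symplectic map on the (open) set `U`. -/
def IsSymplecticOn {d : ℕ} (g : PhaseSpace d → PhaseSpace d) (U : Set (PhaseSpace d)) : Prop :=
  (∀ x ∈ U, DifferentiableAt ℝ g x) ∧
    ∀ x ∈ U, (jacobianMatrix g x)ᵀ * structureMatrix d * jacobianMatrix g x = structureMatrix d

/-- The integrator is symplectic: applied to a Hamiltonian system with smooth Hamiltonian, its
one-step map `x ↦ Φ_{h,J⁻¹∇H}(x)` is, for small `h` and locally in `x`, a symplectic map. -/
def Integrator.IsSymplectic {d : ℕ} (Φ : Integrator (PhaseSpace d)) : Prop :=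
  ∀ H : PhaseSpace d → ℝ, ContDiff ℝ ∞ H → ∀ x : PhaseSpace d,
    ∃ U : Set (PhaseSpace d), IsOpen U ∧ x ∈ U ∧
      ∀ᶠ h in 𝓝 (0 : ℝ), IsSymplecticOn (Φ.step h (hamiltonianField H)) U

/-! Induction on the index. Consistency gives `fk 0 = f`. If the coefficients up to `K` are
Hamiltonian, then for each frozen `s` so is the truncation `f_s^K`, and the integrator's step maps
for it are symplectic for small `h`. How small depends on `s`, so `s = h` cannot simply be
substituted. But the symplecticity defect is smooth in `(h, s)` and vanishes to every order in `h`
at each `s`; such vanishing is locally uniform in `s`, hence survives on the diagonal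
(`isBigO_form_fderivSnd_diagonal`).

The IMDE property and `isBigO_step_truncatedField_succ` give `Φ_{h,f_h^K} = φ_{h,f} - h^(K+2)
f_{K+1} + O(h^(K+3))`, and this may be differentiated in `x` (`isBigO_fderivSnd`). Both Jacobians
tend to the identity and preserve the symplectic form up to `O(h^(K+3))`, so the derivative of
`f_{K+1}` is an infinitesimal symmetry of the form (`form_add_form_eq_zero_of_isBigO`). This says
that the 1-form dual to `f_{K+1}` is closed, and the Poincaré lemma yields `H_{K+1}`. -/

/-! ### Taylor expansions and order estimates in one real variable -/

section Expansions

variable {F P : Type*} [NormedAddCommGroup F] [NormedSpace ℝ F]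

/-- Mean value inequality between `0` and `t`. The filter `l` carries a parameter, so that the
estimate is uniform along it. -/
theorem isBigO_pow_succ_of_hasDerivAt_prod {l : Filter P} {f f' : ℝ × P → F} {n : ℕ}
    (hd : ∀ᶠ q in 𝓝 (0 : ℝ) ×ˢ l, HasDerivAt (fun t => f (t, q.2)) (f' q) q.1)
    (h0 : ∀ᶠ p in l, f (0, p) = 0)
    (hO : f' =O[𝓝 (0 : ℝ) ×ˢ l] fun q => q.1 ^ n) :
    f =O[𝓝 (0 : ℝ) ×ˢ l] fun q => q.1 ^ (n + 1) := by
  obtain ⟨C, hC⟩ := hO.bound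
  obtain ⟨pa, ha, pb, hb, hab⟩ := eventually_prod_iff.1 (hd.and hC)
  obtain ⟨ε, hε, hball⟩ := Metric.eventually_nhds_iff_ball.1 ha
  refine IsBigO.of_bound (|C|) ?_
  refine eventually_prod_iff.2 ⟨fun t => t ∈ Metric.ball (0 : ℝ) ε, Metric.ball_mem_nhds _ hε,
    fun p => pb p ∧ f (0, p) = 0, hb.and h0, ?_⟩
  intro t ht p ⟨hp, hp0⟩
  have hsub : ∀ s ∈ Metric.closedBall (0 : ℝ) |t|, s ∈ Metric.ball (0 : ℝ) ε := by
    intro s hs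
    simp only [Metric.mem_closedBall, dist_zero_right, Real.norm_eq_abs, Metric.mem_ball] at *
    exact hs.trans_lt ht
  have key := (convex_closedBall (0 : ℝ) |t|).norm_image_sub_le_of_norm_hasDerivWithin_le
    (f := fun s => f (s, p)) (f' := fun s => f' (s, p)) (C := |C| * |t| ^ n)
    (x := 0) (y := t)
    (fun s hs => ((hab (hball s (hsub s hs)) hp).1).hasDerivWithinAt)
    (fun s hs => by
      refine ((hab (hball s (hsub s hs)) hp).2).trans ?_
      have hs' : |s| ≤ |t| := by simpa using hs
      rw [norm_pow, Real.norm_eq_abs]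
      gcongr
      exact le_abs_self C)
    (by simp) (by simp)
  simp only [hp0, sub_zero, Real.norm_eq_abs] at key
  simpa [pow_succ, mul_assoc] using key

theorem isBigO_pow_succ_of_hasDerivAt {f f' : ℝ → F} {n : ℕ}
    (hd : ∀ᶠ t in 𝓝 (0 : ℝ), HasDerivAt f (f' t) t) (h0 : f 0 = 0)
    (hO : f' =O[𝓝 0] fun t => t ^ n) : f =O[𝓝 0] fun t => t ^ (n + 1) := by
  -- A one-point parameter space reduces the claim to the uniform version.
  have hfst : Tendsto (Prod.fst : ℝ × Unit → ℝ) (𝓝 0 ×ˢ (pure ())) (𝓝 0) := tendsto_fst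
  have := isBigO_pow_succ_of_hasDerivAt_prod (l := (pure () : Filter Unit))
    (f := fun q => f q.1) (f' := fun q => f' q.1) (n := n) (hfst.eventually hd) (by simpa using h0)
    (hO.comp_tendsto hfst)
  exact this.comp_tendsto (k := fun t : ℝ => (t, ())) (tendsto_id.prodMk tendsto_const_pure)

/-- Taylor's formula for a sequence of functions, each the derivative of the preceding one. -/
theorem taylor_isBigO_of_hasDerivAt {u : ℕ → ℝ → F}
    (hu : ∀ j, ∀ᶠ t in 𝓝 (0 : ℝ), HasDerivAt (u j) (u (j + 1) t) t) (n j : ℕ) :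
    (fun t => u j t - ∑ i ∈ Finset.range n, (t ^ i / i.factorial) • u (j + i) 0) =O[𝓝 0]
      fun t => t ^ n := by
  induction n generalizing j with
  | zero =>
    simpa using (hu j).self_of_nhds.continuousAt.isBigO_one ℝ
  | succ n ih =>
    refine isBigO_pow_succ_of_hasDerivAt (f' := fun t => u (j + 1) t -
      ∑ i ∈ Finset.range n, (t ^ i / i.factorial) • u (j + 1 + i) 0) ?_ ?_ (ih (j + 1))
    · filter_upwards [hu j] with t ht
      have h1 : ∀ i : ℕ, HasDerivAt
          (fun t : ℝ => (t ^ (i + 1) / ((i + 1).factorial : ℝ)) • u (j + (i + 1)) 0)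
          ((t ^ i / i.factorial : ℝ) • u (j + 1 + i) 0) t := by
        intro i
        rw [show j + 1 + i = j + (i + 1) by ring]
        refine HasDerivAt.smul_const ?_ _
        convert (hasDerivAt_pow (i + 1) t).div_const ((i + 1).factorial : ℝ) using 1
        rw [Nat.factorial_succ]
        have : (i.factorial : ℝ) ≠ 0 := by positivity
        have : ((i : ℝ) + 1) ≠ 0 := by positivity
        push_cast
        field_simp
      simp only [Finset.sum_range_succ' _ n, pow_zero]
      exact ht.sub ((HasDerivAt.fun_sum fun i _ => h1 i).add_const _)
    · simp [Finset.sum_range_succ']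

theorem eq_zero_of_pow_smul_isLittleO {c : F} {n : ℕ}
    (h : (fun t : ℝ => t ^ n • c) =o[𝓝 0] fun t => t ^ n) : c = 0 := by
  have h' := h.mono (nhdsWithin_le_nhds (s := {(0 : ℝ)}ᶜ))
  have h2 : Tendsto (fun t : ℝ => (t ^ n)⁻¹ • (t ^ n • c)) (𝓝[≠] 0) (𝓝 0) := by
    have h3 := h'.norm_left.tendsto_div_nhds_zero
    rw [tendsto_zero_iff_norm_tendsto_zero]
    have h4 := h3.norm
    simp only [norm_zero] at h4
    refine h4.congr fun t => ?_
    simp [norm_smul, div_eq_inv_mul]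
  have h3 : Tendsto (fun _ : ℝ => c) (𝓝[≠] 0) (𝓝 0) := by
    refine h2.congr' ?_
    filter_upwards [self_mem_nhdsWithin] with t ht
    rw [smul_smul, inv_mul_cancel₀ (pow_ne_zero _ ht), one_smul]
  exact tendsto_nhds_unique tendsto_const_nhds h3

theorem isLittleO_pow_succ (n : ℕ) : (fun t : ℝ => t ^ (n + 1)) =o[𝓝 0] fun t => t ^ n :=
  isLittleO_pow_pow n.lt_succ_self

theorem isBigO_pow_of_le {m n : ℕ} (h : m ≤ n) : (fun t : ℝ => t ^ n) =O[𝓝 0] fun t => t ^ m := by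
  rcases h.eq_or_lt with rfl | h
  · exact isBigO_refl _ _
  · exact (isLittleO_pow_pow h).isBigO

/-- By Taylor's formula the first nonzero coefficient below order `n` would give a term `t ^ i • c`
of size `O(t ^ (i + 1))`. -/
theorem eq_zero_of_isBigO_pow {u : ℕ → ℝ → F}
    (hu : ∀ j, ∀ᶠ t in 𝓝 (0 : ℝ), HasDerivAt (u j) (u (j + 1) t) t) {n : ℕ}
    (h : u 0 =O[𝓝 0] fun t => t ^ n) : ∀ i < n, u i 0 = 0 := by
  intro i
  induction i using Nat.strong_induction_on with
  | _ i ih =>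
    intro hi
    have h1 := taylor_isBigO_of_hasDerivAt hu (i + 1) 0
    have h2 : (fun t : ℝ => t ^ i • ((i.factorial : ℝ)⁻¹ • u i 0)) =O[𝓝 0]
        fun t => t ^ (i + 1) := by
      have h3 := (h.trans (isBigO_pow_of_le (m := i + 1) hi)).sub h1
      refine h3.congr_left fun t => ?_
      rw [sub_sub_cancel, Finset.sum_range_succ, Finset.sum_eq_zero, zero_add, zero_add, smul_smul,
        div_eq_mul_inv]
      intro k hk
      have hk' := Finset.mem_range.1 hk
      rw [zero_add, ih k hk' (hk'.trans hi), smul_zero]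
    have h4 := eq_zero_of_pow_smul_isLittleO (h2.trans_isLittleO (isLittleO_pow_succ i))
    have : (i.factorial : ℝ)⁻¹ ≠ 0 := by positivity
    exact (smul_eq_zero.1 h4).resolve_left this

/-- Differentiating an order estimate is legitimate here because it forces the Taylor coefficients
below order `n + 1` to vanish, so that `u 1` equals its own Taylor remainder of order `n`. -/
theorem isBigO_pow_of_hasDerivAt {u : ℕ → ℝ → F}
    (hu : ∀ j, ∀ᶠ t in 𝓝 (0 : ℝ), HasDerivAt (u j) (u (j + 1) t) t) {n : ℕ}
    (h : u 0 =O[𝓝 0] fun t => t ^ (n + 1)) : u 1 =O[𝓝 0] fun t => t ^ n := by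
  have h1 := taylor_isBigO_of_hasDerivAt hu n 1
  refine h1.congr_left fun t => ?_
  rw [Finset.sum_eq_zero, sub_zero]
  intro k hk
  rw [eq_zero_of_isBigO_pow hu h (1 + k) (by have := Finset.mem_range.1 hk; lia), smul_zero]

end Expansions

/-! ### Order estimates for smooth families: uniformity and differentiation in the parameter -/

section Parameters

variable {E F P : Type*} [NormedAddCommGroup E] [NormedSpace ℝ E]
  [NormedAddCommGroup F] [NormedSpace ℝ F] [NormedAddCommGroup P] [NormedSpace ℝ P]

theorem ContDiffAt.fderiv_apply_const {f : E → F} {x : E} (hf : ContDiffAt ℝ ∞ f x) (v : E) :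
    ContDiffAt ℝ ∞ (fun z => fderiv ℝ f z v) x :=
  (hf.fderiv_right (m := ∞) (by simp)).clm_apply contDiffAt_const

/-- The partial derivative in the direction of the real variable. -/
noncomputable def derivFst (f : ℝ × P → F) (q : ℝ × P) : F := fderiv ℝ f q (1, 0)

/-- The partial derivative in the direction of the parameter. -/
noncomputable def fderivSnd (f : ℝ × P → F) (q : ℝ × P) : P →L[ℝ] F :=
  (fderiv ℝ f q).comp (ContinuousLinearMap.inr ℝ ℝ P)

theorem ContDiffAt.derivFst {f : ℝ × P → F} {q : ℝ × P} (hf : ContDiffAt ℝ ∞ f q) :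
    ContDiffAt ℝ ∞ (derivFst f) q :=
  hf.fderiv_apply_const _

theorem ContDiffAt.fderivSnd {f : ℝ × P → F} {q : ℝ × P} (hf : ContDiffAt ℝ ∞ f q) :
    ContDiffAt ℝ ∞ (fderivSnd f) q :=
  (hf.fderiv_right (m := ∞) (by simp)).clm_comp contDiffAt_const

theorem ContDiffAt.eventually_of_top {f : E → F} {x : E} (hf : ContDiffAt ℝ ∞ f x) (n : ℕ) :
    ∀ᶠ y in 𝓝 x, ContDiffAt ℝ n f y :=
  (hf.of_le (by exact_mod_cast le_top)).eventually (by simp)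

theorem hasDerivAt_derivFst {f : ℝ × P → F} {q : ℝ × P} (hf : DifferentiableAt ℝ f q) :
    HasDerivAt (fun t => f (t, q.2)) (derivFst f q) q.1 := by
  have h1 : HasDerivAt (fun t : ℝ => (t, q.2)) ((1 : ℝ), (0 : P)) q.1 :=
    (hasDerivAt_id _).prodMk (hasDerivAt_const _ _)
  exact (hf.hasFDerivAt (x := q)).comp_hasDerivAt q.1 h1

theorem hasFDerivAt_fderivSnd {f : ℝ × P → F} {q : ℝ × P} (hf : DifferentiableAt ℝ f q) :
    HasFDerivAt (fun p => f (q.1, p)) (fderivSnd f q) q.2 :=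
  (hf.hasFDerivAt (x := q)).comp q.2 (hasFDerivAt_prodMk_right q.1 q.2)

theorem eventually_hasDerivAt_derivFst {f : ℝ × P → F} {q : ℝ × P} (hf : ContDiffAt ℝ ∞ f q) :
    ∀ᶠ z in 𝓝 q, HasDerivAt (fun t => f (t, z.2)) (derivFst f z) z.1 := by
  filter_upwards [hf.eventually_of_top 1] with z hz
  exact hasDerivAt_derivFst (hz.differentiableAt (by simp))

theorem tendsto_prodMk_const_nhds_zero {P : Type*} [TopologicalSpace P] (p : P) :
    Tendsto (fun t : ℝ => (t, p)) (𝓝 0) (𝓝 (0, p)) :=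
  (Continuous.prodMk_left p).tendsto' _ _ rfl

theorem isBigO_derivFst {f : ℝ × P → F} {p : P} (hf : ContDiffAt ℝ ∞ f (0, p)) {n : ℕ}
    (h : (fun t => f (t, p)) =O[𝓝 0] fun t => t ^ (n + 1)) :
    (fun t => derivFst f (t, p)) =O[𝓝 0] fun t => t ^ n := by
  have hc : ∀ j, ContDiffAt ℝ ∞ (derivFst^[j] f) (0, p) := by
    intro j
    induction j with
    | zero => exact hf
    | succ j ih =>
      rw [Function.iterate_succ_apply']
      exact ih.derivFst
  refine isBigO_pow_of_hasDerivAt (u := fun j t => (derivFst^[j] f) (t, p)) (fun j => ?_) h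
  have := (tendsto_prodMk_const_nhds_zero p).eventually (eventually_hasDerivAt_derivFst (hc j))
  simpa only [Function.iterate_succ_apply'] using this

/-- A smooth family of functions that vanish to order `n` does so locally uniformly. -/
theorem isBigO_nhds_prod_of_forall {f : ℝ × P → F} (hf : ∀ p, ContDiffAt ℝ ∞ f (0, p)) {n : ℕ}
    (h : ∀ p, (fun t => f (t, p)) =O[𝓝 0] fun t => t ^ n) (p : P) :
    f =O[𝓝 (0, p)] fun q => q.1 ^ n := by
  induction n generalizing f with
  | zero => simpa using (hf p).continuousAt.isBigO_one ℝ
  | succ n ih =>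
    -- The time derivative is again a smooth family, of order one less; integrating its uniform
    -- bound recovers the lost power.
    have h1 := ih (fun p => (hf p).derivFst) (fun p => isBigO_derivFst (hf p) (h p))
    have h2 := eventually_hasDerivAt_derivFst (hf p)
    rw [nhds_prod_eq] at *
    refine isBigO_pow_succ_of_hasDerivAt_prod h2 (Eventually.of_forall fun p => ?_) h1
    -- At `t = 0` the bound reads `‖f (0, p)‖ ≤ C * 0 ^ (n + 1) = 0`.
    obtain ⟨C, hC⟩ := (h p).bound
    simpa using hC.self_of_nhds

/-- Symmetry of the second derivative interchanges the time and parameter derivatives. -/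
theorem hasDerivAt_fderivSnd {f : ℝ × P → F} {q : ℝ × P} (hf : ContDiffAt ℝ 2 f q) :
    HasDerivAt (fun t => fderivSnd f (t, q.2)) (fderivSnd (derivFst f) q) q.1 := by
  have hd : DifferentiableAt ℝ (fderiv ℝ f) q :=
    (hf.fderiv_right (m := 1) (by norm_num)).differentiableAt (by simp)
  have hs : IsSymmSndFDerivAt ℝ f q := hf.isSymmSndFDerivAt (by simp)
  have h1 : DifferentiableAt ℝ (fderivSnd f) q := hd.clm_comp (differentiableAt_const _)
  have e1 : fderiv ℝ (derivFst f) q = (fderiv ℝ (fderiv ℝ f) q).flip (1, 0) := by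
    ext w <;>
    simp [show derivFst f = fun z => fderiv ℝ f z (1, 0) from rfl, fderiv_clm_apply hd]
  have e2 : fderiv ℝ (fderivSnd f) q (1, 0) =
      (fderiv ℝ (fderiv ℝ f) q (1, 0)).comp (ContinuousLinearMap.inr ℝ ℝ P) := by
    rw [show fderivSnd f = fun z => (fderiv ℝ f z).comp (ContinuousLinearMap.inr ℝ ℝ P) from rfl,
      fderiv_clm_comp hd (differentiableAt_const _)]
    ext w
    simp
  have h3 : fderivSnd (derivFst f) q = derivFst (fderivSnd f) q := by
    change (fderiv ℝ (derivFst f) q).comp (ContinuousLinearMap.inr ℝ ℝ P) =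
      fderiv ℝ (fderivSnd f) q (1, 0)
    rw [e1, e2]
    ext v
    simpa using hs.eq (0, v) (1, 0)
  rw [h3]
  exact hasDerivAt_derivFst h1

/-- Estimates `O(t ^ n)` for a smooth family can be differentiated in the parameter. -/
theorem isBigO_fderivSnd {f : ℝ × P → F} (hf : ∀ p, ContDiffAt ℝ ∞ f (0, p)) {n : ℕ}
    (h : ∀ p, (fun t => f (t, p)) =O[𝓝 0] fun t => t ^ n) (p : P) :
    (fun t => fderivSnd f (t, p)) =O[𝓝 0] fun t => t ^ n := by
  induction n generalizing f with
  | zero =>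
    simpa using ((hf p).fderivSnd.continuousAt.comp (f := fun t : ℝ => (t, p)) (x := 0)
      (tendsto_prodMk_const_nhds_zero p)).isBigO_one ℝ
  | succ n ih =>
    have h1 := ih (fun p => (hf p).derivFst) (fun p => isBigO_derivFst (hf p) (h p))
    refine isBigO_pow_succ_of_hasDerivAt ?_ ?_ h1
    · exact (tendsto_prodMk_const_nhds_zero p).eventually
        (((hf p).eventually_of_top 2).mono fun z hz => hasDerivAt_fderivSnd hz)
    · have hz : ∀ p, f (0, p) = 0 := by
        intro p
        obtain ⟨C, hC⟩ := (h p).bound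
        simpa using hC.self_of_nhds
      have h2 := hasFDerivAt_fderivSnd ((hf p).differentiableAt (by simp))
      simp only [hz] at h2
      exact h2.unique (hasFDerivAt_const _ _)

/-- If a smooth family vanishes to order `n` at every parameter, then its increments vanish to
order `n` times the increment of the parameter. -/
theorem isBigO_sub_of_forall {f : ℝ × P → F} (hf : ∀ p, ContDiffAt ℝ ∞ f (0, p)) {n : ℕ}
    (h : ∀ p, (fun t => f (t, p)) =O[𝓝 0] fun t => t ^ n) {a b : ℝ → P} {p : P}
    (ha : Tendsto a (𝓝 0) (𝓝 p)) (hb : Tendsto b (𝓝 0) (𝓝 p)) :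
    (fun t => f (t, a t) - f (t, b t)) =O[𝓝 0] fun t => t ^ n * ‖a t - b t‖ := by
  -- The parameter derivative is `O(t ^ n)` uniformly near `p`; the mean value inequality on a ball
  -- around `p` turns this into a Lipschitz bound.
  have h1 := isBigO_nhds_prod_of_forall (fun p => (hf p).fderivSnd) (isBigO_fderivSnd hf h) p
  obtain ⟨C, hC⟩ := h1.bound
  have h2 := hC.and ((hf p).eventually_of_top 1)
  rw [nhds_prod_eq] at h2
  obtain ⟨pa, hpa, pb, hpb, hab⟩ := eventually_prod_iff.1 h2
  obtain ⟨ε, hε, hball⟩ := Metric.eventually_nhds_iff_ball.1 hpb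
  refine IsBigO.of_bound C ?_
  filter_upwards [hpa, ha (Metric.ball_mem_nhds p hε), hb (Metric.ball_mem_nhds p hε)]
    with t ht hat hbt
  have key := (convex_ball p ε).norm_image_sub_le_of_norm_hasFDerivWithin_le
    (f := fun x => f (t, x)) (f' := fun x => fderivSnd f (t, x)) (C := C * ‖t ^ n‖)
    (x := b t) (y := a t)
    (fun x hx => (hasFDerivAt_fderivSnd (q := (t, x))
      ((hab ht (hball x hx)).2.differentiableAt (by simp))).hasFDerivWithinAt)
    (fun x hx => (hab ht (hball x hx)).1) hbt hat
  simpa [mul_assoc] using key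

end Parameters

/-! ### Taylor expansions of the flow and of its variational equation -/

section Flow

variable {E : Type*} [NormedAddCommGroup E] [NormedSpace ℝ E]

/-- The iterated Lie derivatives of the identity along `f`; these are the Taylor coefficients (up
to factorials) of the flow of `f`. -/
noncomputable def lieIterate (f : E → E) : ℕ → E → E
  | 0 => id
  | j + 1 => fun x => fderiv ℝ (lieIterate f j) x (f x)

theorem contDiff_lieIterate {f : E → E} (hf : ContDiff ℝ ∞ f) (j : ℕ) :
    ContDiff ℝ ∞ (lieIterate f j) := by
  induction j with
  | zero => exact contDiff_id
  | succ j ih => exact (ih.fderiv_right (m := ∞) (by simp)).clm_apply hf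

/-- Symmetry of the second derivative puts `f x` in the first slot, the form produced by
differentiating `fderiv ℝ (lieIterate f j)` along a solution. -/
theorem fderiv_lieIterate_succ {f : E → E} (hf : ContDiff ℝ ∞ f) (j : ℕ) (x : E) :
    fderiv ℝ (lieIterate f (j + 1)) x =
      fderiv ℝ (fderiv ℝ (lieIterate f j)) x (f x) +
        (fderiv ℝ (lieIterate f j) x).comp (fderiv ℝ f x) := by
  have hj := contDiff_lieIterate hf j
  have hd : DifferentiableAt ℝ (fderiv ℝ (lieIterate f j)) x :=
    (hj.fderiv_right (m := ∞) (by simp)).differentiable (by simp) x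
  have hs : IsSymmSndFDerivAt ℝ (lieIterate f j) x :=
    hj.contDiffAt.isSymmSndFDerivAt (by simp [← WithTop.coe_ofNat])
  ext v
  rw [show lieIterate f (j + 1) = fun x => fderiv ℝ (lieIterate f j) x (f x) from rfl,
    fderiv_clm_apply hd (hf.differentiable (by simp) x)]
  simp [hs.eq v (f x), add_comm]

theorem IsSolution.taylor {f : E → E} (hf : ContDiff ℝ ∞ f) {x : E} {y : ℝ → E}
    (hy : IsSolution f x y) (n : ℕ) :
    (fun t => y t - ∑ i ∈ Finset.range n, (t ^ i / i.factorial) • lieIterate f i x) =O[𝓝 0]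
      fun t => t ^ n := by
  have h := taylor_isBigO_of_hasDerivAt (u := fun j t => lieIterate f j (y t)) (fun j => ?_) n 0
  · simpa [hy.1, lieIterate] using h
  · filter_upwards [hy.2] with t ht
    exact ((contDiff_lieIterate hf j).differentiable (by simp) (y t)).hasFDerivAt.comp_hasDerivAt
      t ht

/-- `Z` solves the variational equation of `f` along `y`, starting from the identity. -/
def IsVariationalSolution (f : E → E) (y : ℝ → E) (Z : ℝ → E →L[ℝ] E) : Prop :=
  Z 0 = ContinuousLinearMap.id ℝ E ∧
    ∀ᶠ t in 𝓝 (0 : ℝ), HasDerivAt Z ((fderiv ℝ f (y t)).comp (Z t)) t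

/-- The Taylor coefficients of `Z` are the `x`-derivatives of those of the flow. Thus `Z` serves as
the flow's Jacobian, although differentiability of the flow in `x` is never used. -/
theorem IsVariationalSolution.taylor {f : E → E} (hf : ContDiff ℝ ∞ f) {x : E} {y : ℝ → E}
    {Z : ℝ → E →L[ℝ] E} (hy : IsSolution f x y) (hZ : IsVariationalSolution f y Z) (n : ℕ) :
    (fun t => Z t - ∑ i ∈ Finset.range n, (t ^ i / i.factorial) • fderiv ℝ (lieIterate f i) x)
      =O[𝓝 0] fun t => t ^ n := by
  have h := taylor_isBigO_of_hasDerivAt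
    (u := fun j t => (fderiv ℝ (lieIterate f j) (y t)).comp (Z t)) (fun j => ?_) n 0
  · simpa [hy.1, lieIterate, hZ.1] using h
  · filter_upwards [hy.2, hZ.2] with t ht hZt
    have hd : DifferentiableAt ℝ (fderiv ℝ (lieIterate f j)) (y t) :=
      ((contDiff_lieIterate hf j).fderiv_right (m := ∞) (by simp)).differentiable (by simp) _
    have := (hd.hasFDerivAt.comp_hasDerivAt t ht).clm_comp hZt
    refine this.congr_deriv ?_
    rw [fderiv_lieIterate_succ hf]
    ext v
    simp

theorem exists_isSolution_isVariationalSolution [CompleteSpace E] {f : E → E}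
    (hf : ContDiff ℝ ∞ f) (x : E) :
    ∃ (y : ℝ → E) (Z : ℝ → E →L[ℝ] E), IsSolution f x y ∧ IsVariationalSolution f y Z := by
  have hf' : ContDiff ℝ ∞ (fun q : E × (E →L[ℝ] E) => (f q.1, (fderiv ℝ f q.1).comp q.2)) := by
    refine (hf.comp contDiff_fst).prodMk (ContDiff.clm_comp ?_ contDiff_snd)
    exact (hf.fderiv_right (m := ∞) (by simp)).comp contDiff_fst
  -- Picard–Lindelöf for the coupled system of the equation and its variational equation.
  obtain ⟨α, h0, ε, hε, hα⟩ :=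
    ContDiffAt.exists_forall_mem_closedBall_exists_eq_forall_mem_Ioo_hasDerivAt₀
    (hf'.contDiffAt.of_le (by exact_mod_cast le_top) :
      ContDiffAt ℝ 1 _ (x, ContinuousLinearMap.id ℝ E)) 0
  have hev : ∀ᶠ t in 𝓝 (0 : ℝ), t ∈ Set.Ioo (0 - ε) (0 + ε) :=
    Ioo_mem_nhds (by linarith) (by linarith)
  refine ⟨fun t => (α t).1, fun t => (α t).2, ⟨by simp [h0], ?_⟩, ⟨by simp [h0], ?_⟩⟩
  · filter_upwards [hev] with t ht
    exact hasFDerivAt_fst.comp_hasDerivAt t (hα t ht)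
  · filter_upwards [hev] with t ht
    exact hasFDerivAt_snd.comp_hasDerivAt t (hα t ht)

/-- The bilinear form `b` is infinitesimally invariant under the vector field `f`. -/
def IsInfinitesimallyInvariant (b : E →L[ℝ] E →L[ℝ] ℝ) (f : E → E) : Prop :=
  ∀ x ξ η, b (fderiv ℝ f x ξ) η + b ξ (fderiv ℝ f x η) = 0

theorem IsVariationalSolution.isBigO_form {b : E →L[ℝ] E →L[ℝ] ℝ} {f : E → E}
    (hb : IsInfinitesimallyInvariant b f) {y : ℝ → E} {Z : ℝ → E →L[ℝ] E}
    (hZ : IsVariationalSolution f y Z) (ξ η : E) (n : ℕ) :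
    (fun t => b (Z t ξ) (Z t η) - b ξ η) =O[𝓝 0] fun t => t ^ (n + 1) := by
  refine isBigO_pow_succ_of_hasDerivAt (f' := fun _ => 0) ?_ (by simp [hZ.1])
    (isBigO_zero _ _)
  filter_upwards [hZ.2] with t ht
  have h1 : ∀ v, HasDerivAt (fun t => Z t v) (fderiv ℝ f (y t) (Z t v)) t := fun v => by
    simpa using ht.clm_apply (hasDerivAt_const t v)
  have h2 := ((b.hasFDerivAt.comp_hasDerivAt t (h1 ξ)).clm_apply (h1 η)).sub_const (b ξ η)
  exact h2.congr_deriv (hb (y t) (Z t ξ) (Z t η))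

/-- If two families of linear maps tending to the identity both preserve `b` up to higher order,
the leading term of their difference is an infinitesimal symmetry of `b`. -/
theorem form_add_form_eq_zero_of_isBigO {b : E →L[ℝ] E →L[ℝ] ℝ} {A Z : ℝ → E →L[ℝ] E}
    {B : E →L[ℝ] E} {ξ η : E} {n : ℕ}
    (hA : Tendsto A (𝓝 0) (𝓝 (ContinuousLinearMap.id ℝ E)))
    (hZ : Tendsto Z (𝓝 0) (𝓝 (ContinuousLinearMap.id ℝ E)))
    (hAZ : (fun t => A t - Z t + t ^ n • B) =O[𝓝 0] fun t => t ^ (n + 1))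
    (hAb : (fun t => b (A t ξ) (A t η) - b ξ η) =O[𝓝 0] fun t => t ^ (n + 1))
    (hZb : (fun t => b (Z t ξ) (Z t η) - b ξ η) =O[𝓝 0] fun t => t ^ (n + 1)) :
    b (B ξ) η + b ξ (B η) = 0 := by
  refine eq_zero_of_pow_smul_isLittleO (n := n) ?_
  have hev : ∀ {C : ℝ → E →L[ℝ] E}, Tendsto C (𝓝 0) (𝓝 (ContinuousLinearMap.id ℝ E)) →
      ∀ v, Tendsto (fun t => C t v) (𝓝 0) (𝓝 v) := fun hC v =>
    ((ContinuousLinearMap.apply ℝ E v).continuous.tendsto _).comp hC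
  have hR : ∀ v, (fun t => (A t - Z t + t ^ n • B) v) =o[𝓝 0] fun t => t ^ n := fun v =>
    ((ContinuousLinearMap.apply ℝ E v).isBigO_comp _ _ |>.trans hAZ).trans_isLittleO
      (isLittleO_pow_succ n)
  have hbd : ∀ {C : ℝ → E →L[ℝ] E}, Tendsto C (𝓝 0) (𝓝 (ContinuousLinearMap.id ℝ E)) →
      ∀ v, (fun t => C t v) =O[𝓝 0] fun _ => (1 : ℝ) := fun hC v => (hev hC v).isBigO_one ℝ
  have hsub : ∀ {C : ℝ → E →L[ℝ] E}, Tendsto C (𝓝 0) (𝓝 (ContinuousLinearMap.id ℝ E)) →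
      ∀ v, (fun t => v - C t v) =o[𝓝 0] fun _ => (1 : ℝ) := fun hC v => by
    rw [isLittleO_one_iff]
    simpa using (hev hC v).const_sub v
  have hB : ∀ v, (fun t : ℝ => t ^ n • B v) =O[𝓝 0] fun t => t ^ n := fun v => by
    simpa using (isBigO_refl (fun t : ℝ => t ^ n) (𝓝 0)).smul
      (isBigO_const_const (B v) (one_ne_zero (α := ℝ)) (𝓝 0))
  have hform : ∀ u v : ℝ → E, (fun t => b (u t) (v t)) =O[𝓝 0] fun t => ‖u t‖ * ‖v t‖ :=
    fun u v => b.isBoundedBilinearMap.isBigO_comp (g := u) (h := v)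
  -- With `R = A - Z + t ^ n • B`, bilinearity gives `t ^ n (b (B ξ) (A η) + b (Z ξ) (B η)) = b (R
  -- ξ) (A η) + b (Z ξ) (R η) - (b (A ξ) (A η) - b (Z ξ) (Z η))`. The terms `h3` and `h4` then
  -- replace `A η` by `η` and `Z ξ` by `ξ`.
  have h1 : (fun t => b ((A t - Z t + t ^ n • B) ξ) (A t η)) =o[𝓝 0] fun t => t ^ n :=
    (hform _ _).trans_isLittleO <| by
      simpa using (hR ξ).norm_left.mul_isBigO (hbd hA η).norm_left
  have h2 : (fun t => b (Z t ξ) ((A t - Z t + t ^ n • B) η)) =o[𝓝 0] fun t => t ^ n :=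
    (hform _ _).trans_isLittleO <| by
      simpa using (hbd hZ ξ).norm_left.mul_isLittleO (hR η).norm_left
  have h3 : (fun t => b (t ^ n • B ξ) (η - A t η)) =o[𝓝 0] fun t => t ^ n :=
    (hform _ _).trans_isLittleO <| by
      simpa only [mul_one] using (hB ξ).norm_left.mul_isLittleO (hsub hA η).norm_left
  have h4 : (fun t => b (ξ - Z t ξ) (t ^ n • B η)) =o[𝓝 0] fun t => t ^ n :=
    (hform _ _).trans_isLittleO <| by
      simpa only [one_mul] using (hsub hZ ξ).norm_left.mul_isBigO (hB η).norm_left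
  have h5 := (hAb.sub hZb).trans_isLittleO (isLittleO_pow_succ n)
  refine ((((h1.add h2).sub h5).add h3).add h4).congr_left fun t => ?_
  simp only [map_sub, map_add, map_smul, add_apply,
    sub_apply, smul_apply, smul_eq_mul]
  ring

end Flow

/-! ### Coefficients of the inverse modified equation -/

section IMDE

variable {E : Type*} [NormedAddCommGroup E] [NormedSpace ℝ E]

theorem contDiff_truncatedField {fk : ℕ → E → E} (hfk : ∀ k, ContDiff ℝ ∞ (fk k)) (K : ℕ) :
    ContDiff ℝ ∞ (fun q : ℝ × E => truncatedField fk K q.1 q.2) :=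
  ContDiff.sum fun k _ => (contDiff_fst.pow k).smul ((hfk k).comp contDiff_snd)

theorem exists_isSolution [CompleteSpace E] {f : E → E} (hf : ContDiff ℝ ∞ f) (x : E) :
    ∃ y, IsSolution f x y :=
  let ⟨y, _, hy, _⟩ := exists_isSolution_isVariationalSolution hf x
  ⟨y, hy⟩

theorem IsSolution.isBigO_euler {f : E → E} (hf : ContDiff ℝ ∞ f) {x : E} {y : ℝ → E}
    (hy : IsSolution f x y) :
    (fun h => y h - x - h • f x) =O[𝓝 0] fun h => h ^ 2 := by
  simpa [Finset.sum_range_succ, lieIterate, sub_sub] using hy.taylor hf 2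

theorem Integrator.IsConsistent.isBigO_sub {Φ : Integrator E}
    (hΦ : Φ.IsConsistent) {f : E → E} (hf : ContDiff ℝ ∞ f) {x : E} {y : ℝ → E}
    (hy : IsSolution f x y) :
    (fun h => Φ.step h f x - y h) =O[𝓝 0] fun h => h ^ 2 := by
  obtain ⟨p, hp, ho⟩ := hΦ
  exact (ho f hf x y hy).trans (isBigO_pow_of_le (by lia))

theorem Integrator.IsConsistent.isBigO_euler [CompleteSpace E] {Φ : Integrator E}
    (hΦ : Φ.IsConsistent) {f : E → E} (hf : ContDiff ℝ ∞ f) (x : E) :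
    (fun h => Φ.step h f x - x - h • f x) =O[𝓝 0] fun h => h ^ 2 := by
  obtain ⟨y, hy⟩ := exists_isSolution hf x
  refine ((hΦ.isBigO_sub hf hy).add (hy.isBigO_euler hf)).congr_left fun h => ?_
  abel

theorem Integrator.IsConsistent.step_zero [CompleteSpace E] {Φ : Integrator E}
    (hΦ : Φ.IsConsistent) {f : E → E} (hf : ContDiff ℝ ∞ f) (x : E) : Φ.step 0 f x = x := by
  obtain ⟨C, hC⟩ := (hΦ.isBigO_euler hf x).bound
  simpa [sub_eq_zero] using hC.self_of_nhds

/-- The leading coefficient of the inverse modified equation is the given vector field. -/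
theorem IsIMDE.coeff_zero [CompleteSpace E] {Φ : Integrator E} (hΦ : Φ.IsConsistent)
    {f : E → E} (hf : ContDiff ℝ ∞ f) {fk : ℕ → E → E} (h : IsIMDE Φ f fk) : fk 0 = f := by
  ext1 x
  obtain ⟨y, hy⟩ := exists_isSolution hf x
  have h1 := h.expansion 0 x y hy
  have e : ∀ s, truncatedField fk 0 s = fk 0 := fun s => by
    ext1 x
    simp [truncatedField]
  simp only [e] at h1
  have h2 := hΦ.isBigO_euler (h.smooth 0) x
  have h3 := hy.isBigO_euler hf
  refine sub_eq_zero.1 (eq_zero_of_pow_smul_isLittleO (n := 1) ?_)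
  refine (((h1.add h3).sub h2).trans_isLittleO (isLittleO_pow_succ 1)).congr_left fun t => ?_
  rw [pow_one, smul_sub]
  abel

/-- Adding the next term of the inverse modified equation changes the numerical solution by that
term, to leading order. -/
theorem Integrator.IsConsistent.isBigO_step_truncatedField_succ [CompleteSpace E]
    {Φ : Integrator E} (hΦ : Φ.IsConsistent) {fk : ℕ → E → E}
    (hfk : ∀ k, ContDiff ℝ ∞ (fk k)) (K : ℕ) (x : E) :
    (fun h => Φ.step h (truncatedField fk (K + 1) h) x - Φ.step h (truncatedField fk K h) x -
      h ^ (K + 2) • fk (K + 1) x) =O[𝓝 0] fun h => h ^ (K + 3) := by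
  -- Two independent parameters: the step size inside the truncation, and the factor of the next
  -- term, later set to `h ^ (K + 1)` or `0`. The Euler defect `δ` is `O(h ^ 2)` at each fixed
  -- parameter, so its increment is `O(h ^ 2 * h ^ (K + 1))`.
  let F : EuclideanSpace ℝ (Fin 2) → E → E :=
    fun p x => truncatedField fk K (p 0) x + p 1 • fk (K + 1) x
  have hF : ContDiff ℝ ∞ (fun q : EuclideanSpace ℝ (Fin 2) × E => F q.1 q.2) := by
    have h0 : ∀ i, ContDiff ℝ ∞ (fun q : EuclideanSpace ℝ (Fin 2) × E => q.1 i) := fun i => by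
      fun_prop
    exact ((contDiff_truncatedField hfk K).comp ((h0 0).prodMk contDiff_snd)).add
      ((h0 1).smul ((hfk (K + 1)).comp contDiff_snd))
  have hFp : ∀ p, ContDiff ℝ ∞ (F p) := fun p => hF.comp (contDiff_prodMk_right p)
  let δ : ℝ × EuclideanSpace ℝ (Fin 2) → E := fun q => Φ.step q.1 (F q.2) x - x - q.1 • F q.2 x
  have hδ : ∀ p, ContDiffAt ℝ ∞ δ (0, p) := fun p => by
    have h1 := (Φ.smooth 2 F hF p x).comp (0, p)
      (f := fun q : ℝ × EuclideanSpace ℝ (Fin 2) => (q.1, q.2, x))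
      (contDiffAt_fst.prodMk (contDiffAt_snd.prodMk contDiffAt_const))
    exact (h1.sub contDiffAt_const).sub
      (contDiffAt_fst.smul (hF.comp (contDiff_snd.prodMk contDiff_const)).contDiffAt)
  have hlim : ∀ b : ℝ → ℝ, Continuous b → b 0 = 0 →
      Tendsto (fun h => !₂[h, b h]) (𝓝 0) (𝓝 (0 : EuclideanSpace ℝ (Fin 2))) := by
    intro b hb hb0
    have hc : Continuous (fun h => !₂[h, b h]) := by fun_prop
    refine hc.tendsto' _ _ ?_
    ext i
    fin_cases i <;> simp [hb0]
  have key := isBigO_sub_of_forall hδ (n := 2) (fun p => hΦ.isBigO_euler (hFp p) x)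
    (hlim (fun h => h ^ (K + 1)) (by fun_prop) (by simp)) (hlim (fun _ => 0) (by fun_prop) rfl)
  have e1 : ∀ h, F !₂[h, h ^ (K + 1)] = truncatedField fk (K + 1) h := fun h => by
    ext1 z
    simp [F, truncatedField, Finset.sum_range_succ _ (K + 1)]
  have e2 : ∀ h, F !₂[h, 0] = truncatedField fk K h := fun h => by
    ext1 z
    simp [F]
  have e3 : ∀ h : ℝ, ‖!₂[h, h ^ (K + 1)] - !₂[h, 0]‖ = |h| ^ (K + 1) := fun h => by
    simp [EuclideanSpace.norm_eq, Fin.sum_univ_two, Real.sqrt_sq_eq_abs]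
  refine IsBigO.congr_left (f₁ := fun t => δ (t, !₂[t, t ^ (K + 1)]) - δ (t, !₂[t, 0])) ?_ ?_
  · refine key.trans (IsBigO.of_bound 1 (Eventually.of_forall fun h => ?_))
    rw [e3]
    simp [show K + 3 = 2 + (K + 1) by ring, pow_add]
  · intro h
    simp only [δ, e1, e2]
    have : truncatedField fk (K + 1) h x = truncatedField fk K h x + h ^ (K + 1) • fk (K + 1) x := by
      simp [truncatedField, Finset.sum_range_succ _ (K + 1)]
    rw [this, smul_add, smul_smul, ← pow_succ']
    abel

/-- If each member of a smooth family of one-step maps preserves `b` for small step sizes, then so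
does, to every order, the map whose parameter is the step size. -/
theorem isBigO_form_fderivSnd_diagonal {b : E →L[ℝ] E →L[ℝ] ℝ} {g : ℝ × ℝ × E → E} {x : E}
    (hg : ∀ s, ContDiffAt ℝ ∞ g (0, s, x)) (ξ η : E)
    (hb : ∀ s, ∀ᶠ h in 𝓝 (0 : ℝ), b (fderiv ℝ (fun z => g (h, s, z)) x ξ)
      (fderiv ℝ (fun z => g (h, s, z)) x η) = b ξ η) (n : ℕ) :
    (fun h => b (fderiv ℝ (fun z => g (h, h, z)) x ξ) (fderiv ℝ (fun z => g (h, h, z)) x η) -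
      b ξ η) =O[𝓝 0] fun h => h ^ n := by
  let A : E → ℝ × ℝ → E := fun v q => fderiv ℝ g (q.1, q.2, x) (0, 0, v)
  have hA : ∀ v s, ContDiffAt ℝ ∞ (A v) (0, s) := fun v s =>
    ((hg s).fderiv_apply_const (0, 0, v)).comp (0, s)
      (f := fun q : ℝ × ℝ => (q.1, q.2, x))
      (contDiffAt_fst.prodMk (contDiffAt_snd.prodMk contDiffAt_const))
  have hAg : ∀ s, ∀ᶠ q : ℝ × ℝ in 𝓝 (0, s), ∀ v,
      fderiv ℝ (fun z => g (q.1, q.2, z)) x v = A v q := by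
    intro s
    have ht : Tendsto (fun q : ℝ × ℝ => (q.1, q.2, x)) (𝓝 (0, s)) (𝓝 (0, s, x)) :=
      (by fun_prop : Continuous fun q : ℝ × ℝ => (q.1, q.2, x)).tendsto' _ _ rfl
    filter_upwards [ht.eventually ((hg s).eventually_of_top 1)] with q hq v
    have h1 : HasFDerivAt (fun z => (q.1, q.2, z))
        ((ContinuousLinearMap.inr ℝ ℝ (ℝ × E)).comp (ContinuousLinearMap.inr ℝ ℝ E)) x :=
      (hasFDerivAt_prodMk_right q.1 (q.2, x)).comp x (hasFDerivAt_prodMk_right q.2 x)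
    have h2 := (hq.differentiableAt (by simp)).hasFDerivAt.comp x h1
    exact congrArg (fun T => T v) h2.fderiv
  have hm : ∀ s, ContDiffAt ℝ ∞ (fun q => b (A ξ q) (A η q) - b ξ η) (0, s) := fun s =>
    ((b.contDiff.contDiffAt.comp (0, s) (hA ξ s)).clm_apply (hA η s)).sub contDiffAt_const
  -- For each `s` the defect vanishes on an `s`-dependent interval, hence to order `n`; uniformity
  -- near `s = 0` permits restriction to the diagonal.
  have h0 := isBigO_nhds_prod_of_forall (n := n) hm (fun s => ?_) 0
  · have ht : Tendsto (fun h : ℝ => (h, h)) (𝓝 0) (𝓝 (0, 0)) :=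
      (by fun_prop : Continuous fun h : ℝ => (h, h)).tendsto' _ _ rfl
    refine IsBigO.congr' (h0.comp_tendsto ht) ?_ EventuallyEq.rfl
    filter_upwards [ht.eventually (hAg 0)] with h hh
    simp [hh]
  · refine IsBigO.congr' (isBigO_zero _ _) ?_ EventuallyEq.rfl
    filter_upwards [hb s, (tendsto_prodMk_const_nhds_zero s).eventually (hAg s)] with h h1 h2
    simp only [h2] at h1
    rw [h1, sub_self]

theorem Integrator.contDiffAt_step_truncatedField (Φ : Integrator E) {fk : ℕ → E → E}
    (hfk : ∀ k, ContDiff ℝ ∞ (fk k)) (K : ℕ) (s : ℝ) (x : E) :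
    ContDiffAt ℝ ∞ (fun q : ℝ × ℝ × E => Φ.step q.1 (truncatedField fk K q.2.1) q.2.2)
      (0, s, x) := by
  have hF : ContDiff ℝ ∞
      (fun q : EuclideanSpace ℝ (Fin 1) × E => truncatedField fk K (q.1 0) q.2) :=
    (contDiff_truncatedField hfk K).comp (f := fun q : EuclideanSpace ℝ (Fin 1) × E => (q.1 0, q.2))
      (by fun_prop)
  have hι : ContDiff ℝ ∞ (fun q : ℝ × ℝ × E => (q.1, !₂[q.2.1], q.2.2)) := by
    refine contDiff_fst.prodMk (ContDiff.prodMk ?_ (by fun_prop))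
    refine contDiff_euclidean.2 fun i => ?_
    fin_cases i
    simp only [Fin.zero_eta, Matrix.cons_val_zero]
    fun_prop
  have := (Φ.smooth 1 (fun p => truncatedField fk K (p 0)) hF (!₂[s]) x).comp (0, s, x)
    hι.contDiffAt
  simpa [Function.comp_def] using this

/-- The inductive step: if the truncated inverse modified equation generates numerical solutions
that preserve `b`, its next coefficient is infinitesimally `b`-invariant. -/
theorem IsIMDE.isInfinitesimallyInvariant_succ [CompleteSpace E] {Φ : Integrator E}
    (hΦ : Φ.IsConsistent) {b : E →L[ℝ] E →L[ℝ] ℝ} {f : E → E} (hf : ContDiff ℝ ∞ f)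
    (hb : IsInfinitesimallyInvariant b f) {fk : ℕ → E → E} (h : IsIMDE Φ f fk) (K : ℕ)
    (hK : ∀ (s : ℝ) (x : E), ∀ᶠ h in 𝓝 (0 : ℝ), ∀ ξ η : E,
      b (fderiv ℝ (Φ.step h (truncatedField fk K s)) x ξ)
        (fderiv ℝ (Φ.step h (truncatedField fk K s)) x η) = b ξ η) :
    IsInfinitesimallyInvariant b (fk (K + 1)) := by
  intro x ξ η
  have hg := Φ.contDiffAt_step_truncatedField h.smooth K
  let r : ℝ × E → E := fun q => Φ.step q.1 (truncatedField fk K q.1) q.2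
  have hr : ∀ z, ContDiffAt ℝ ∞ r (0, z) := fun z =>
    (hg 0 z).comp (0, z) (f := fun q : ℝ × E => (q.1, q.1, q.2)) (by fun_prop)
  -- The flow is replaced by its Taylor polynomial, which is visibly smooth in the initial value, so
  -- the estimate on `δ` can be differentiated.
  let δ : ℝ × E → E := fun q => r q -
    ∑ i ∈ Finset.range (K + 3), (q.1 ^ i / i.factorial) • lieIterate f i q.2 +
      q.1 ^ (K + 2) • fk (K + 1) q.2
  have hδ : ∀ z, ContDiffAt ℝ ∞ δ (0, z) := fun z => by
    refine ((hr z).sub (ContDiffAt.sum fun i _ => ?_)).add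
      ((contDiffAt_fst.pow _).smul ((h.smooth (K + 1)).comp contDiff_snd).contDiffAt)
    exact ((contDiffAt_fst.pow i).div_const _).smul
      ((contDiff_lieIterate hf i).comp contDiff_snd).contDiffAt
  have hδO : ∀ z, (fun t => δ (t, z)) =O[𝓝 0] fun t => t ^ (K + 3) := fun z => by
    obtain ⟨y, hy⟩ := exists_isSolution hf z
    have h1 := h.expansion (K + 1) z y hy
    have h2 := hy.taylor hf (K + 3)
    have h3 := hΦ.isBigO_step_truncatedField_succ h.smooth K z
    refine ((h1.add h2).sub h3).congr_left fun t => ?_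
    simp only [δ, r]
    abel
  have hA : ∀ᶠ t in 𝓝 (0 : ℝ), fderivSnd r (t, x) =
      fderiv ℝ (fun z => Φ.step t (truncatedField fk K t) z) x := by
    filter_upwards [(tendsto_prodMk_const_nhds_zero x).eventually ((hr x).eventually_of_top 1)]
      with t ht
    exact (hasFDerivAt_fderivSnd (ht.differentiableAt (by simp))).fderiv.symm
  have hδ' : ∀ᶠ t in 𝓝 (0 : ℝ), fderivSnd δ (t, x) = fderivSnd r (t, x) -
      ∑ i ∈ Finset.range (K + 3), (t ^ i / i.factorial) • fderiv ℝ (lieIterate f i) x +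
        t ^ (K + 2) • fderiv ℝ (fk (K + 1)) x := by
    filter_upwards [(tendsto_prodMk_const_nhds_zero x).eventually ((hr x).eventually_of_top 1),
      (tendsto_prodMk_const_nhds_zero x).eventually ((hδ x).eventually_of_top 1)] with t ht hδt
    have hL : ∀ i : ℕ, HasFDerivAt (fun z => (t ^ i / i.factorial : ℝ) • lieIterate f i z)
        ((t ^ i / i.factorial : ℝ) • fderiv ℝ (lieIterate f i) x) x := fun i =>
      ((contDiff_lieIterate hf i).differentiable (by simp) x).hasFDerivAt.fun_const_smul _
    have hk : HasFDerivAt (fun z => t ^ (K + 2) • fk (K + 1) z)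
        (t ^ (K + 2) • fderiv ℝ (fk (K + 1)) x) x :=
      ((h.smooth (K + 1)).differentiable (by simp) x).hasFDerivAt.fun_const_smul _
    exact (hasFDerivAt_fderivSnd (hδt.differentiableAt (by simp))).unique
      (((hasFDerivAt_fderivSnd (ht.differentiableAt (by simp))).sub
        (HasFDerivAt.fun_sum fun i _ => hL i)).add hk)
  obtain ⟨y, Z, hy, hZ⟩ := exists_isSolution_isVariationalSolution hf x
  refine form_add_form_eq_zero_of_isBigO (A := fun t => fderivSnd r (t, x)) (Z := Z) (n := K + 2)
    ?_ ?_ ?_ ?_ (hZ.isBigO_form hb ξ η (K + 2))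
  · have h1 := (hr x).fderivSnd.continuousAt.tendsto.comp (tendsto_prodMk_const_nhds_zero x)
    have h2 : fderivSnd r (0, x) = ContinuousLinearMap.id ℝ E := by
      refine (hasFDerivAt_fderivSnd ((hr x).differentiableAt (by simp))).unique ?_
      have h3 : ∀ z, r (0, z) = z := fun z => hΦ.step_zero
        ((contDiff_truncatedField h.smooth K).comp (contDiff_prodMk_right 0)) z
      simp only [h3]
      exact hasFDerivAt_id x
    rwa [h2] at h1
  · have h1 := hZ.2.self_of_nhds.continuousAt.tendsto
    rwa [hZ.1] at h1
  -- The differentiated Taylor polynomial cancels against the Taylor polynomial of `Z`.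
  · refine IsBigO.congr' ((isBigO_fderivSnd hδ hδO x).sub (hZ.taylor hf hy (K + 3))) ?_
      EventuallyEq.rfl
    filter_upwards [hδ'] with t ht
    rw [ht]
    abel
  · refine IsBigO.congr' (isBigO_form_fderivSnd_diagonal (fun s => hg s x) ξ η
      (fun s => (hK s x).mono fun _ h => h ξ η) (K + 3)) ?_ EventuallyEq.rfl
    filter_upwards [hA] with t ht
    rw [ht]

end IMDE

/-! ### Symplectic form and Hamiltonian vector fields on phase space -/

section PhaseSpace

variable {d : ℕ}

/-- The symplectic form `(v, w) ↦ vᵀ J w`. -/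
noncomputable def symplecticForm (d : ℕ) : PhaseSpace d →L[ℝ] PhaseSpace d →L[ℝ] ℝ :=
  (innerSL ℝ).bilinearComp (ContinuousLinearMap.id ℝ (PhaseSpace d))
    (Matrix.toEuclideanCLM (𝕜 := ℝ) (structureMatrix d))

theorem symplecticForm_apply (v w : PhaseSpace d) :
    symplecticForm d v w = v.ofLp ⬝ᵥ (structureMatrix d *ᵥ w.ofLp) := by
  simp [symplecticForm, PiLp.inner_apply, dotProduct, Matrix.ofLp_toEuclideanCLM, mul_comm]

theorem structureMatrix_transpose : (structureMatrix d)ᵀ = -structureMatrix d := by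
  simp [structureMatrix, Matrix.fromBlocks_transpose, Matrix.fromBlocks_neg]

theorem structureMatrix_mul_self : structureMatrix d * structureMatrix d = -1 := by
  simp [structureMatrix, Matrix.fromBlocks_multiply, ← Matrix.fromBlocks_one,
    Matrix.fromBlocks_neg]

theorem structureMatrix_inv : (structureMatrix d)⁻¹ = -structureMatrix d :=
  Matrix.inv_eq_right_inv (by rw [mul_neg, structureMatrix_mul_self, neg_neg])

theorem symplecticForm_swap (v w : PhaseSpace d) :
    symplecticForm d v w = -symplecticForm d w v := by
  rw [symplecticForm_apply, symplecticForm_apply, Matrix.dotProduct_mulVec, dotProduct_comm,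
    ← Matrix.mulVec_transpose, structureMatrix_transpose, Matrix.neg_mulVec, dotProduct_neg]

/-- Trades the gradient for a 1-form, so that being Hamiltonian becomes exactness. -/
theorem eq_hamiltonianField_iff {H : PhaseSpace d → ℝ} {y v : PhaseSpace d} :
    v = hamiltonianField H y ↔ fderiv ℝ H y = (symplecticForm d).flip v := by
  have h1 : ∀ w : PhaseSpace d, fderiv ℝ H y w = w.ofLp ⬝ᵥ (gradient H y).ofLp := fun w => by
    rw [← InnerProductSpace.toDual_symm_apply (𝕜 := ℝ) (x := w) (y := fderiv ℝ H y),
      EuclideanSpace.inner_eq_star_dotProduct]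
    rfl
  constructor
  · rintro rfl
    ext w
    rw [h1, ContinuousLinearMap.flip_apply, symplecticForm_apply, hamiltonianField,
      structureMatrix_inv, Matrix.mulVec_mulVec, mul_neg, structureMatrix_mul_self, neg_neg,
      Matrix.one_mulVec]
  · intro h
    have h2 : (gradient H y).ofLp = structureMatrix d *ᵥ v.ofLp := by
      refine (dotProduct_eq _ _ fun w => ?_).symm
      have := congrArg (fun T => T (WithLp.toLp 2 w)) h
      simp only [h1, ContinuousLinearMap.flip_apply, symplecticForm_apply] at this
      rw [dotProduct_comm, ← this, dotProduct_comm]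
    rw [hamiltonianField, h2, structureMatrix_inv, Matrix.mulVec_mulVec, neg_mul,
      structureMatrix_mul_self, neg_neg, Matrix.one_mulVec]

theorem contDiff_hamiltonianField {H : PhaseSpace d → ℝ} (hH : ContDiff ℝ ∞ H) :
    ContDiff ℝ ∞ (hamiltonianField H) := by
  have h1 : ContDiff ℝ ∞ (gradient H) :=
    (InnerProductSpace.toDual ℝ (PhaseSpace d)).symm.toContinuousLinearEquiv.contDiff.comp
      (hH.fderiv_right (m := ∞) (by simp))
  exact (Matrix.toEuclideanCLM (𝕜 := ℝ) (structureMatrix d)⁻¹).contDiff.comp h1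

/-- The Hessian of `H` is symmetric and the symplectic form antisymmetric. -/
theorem isInfinitesimallyInvariant_hamiltonianField {H : PhaseSpace d → ℝ}
    (hH : ContDiff ℝ ∞ H) : IsInfinitesimallyInvariant (symplecticForm d) (hamiltonianField H) := by
  intro x ξ η
  have hs : IsSymmSndFDerivAt ℝ H x :=
    hH.contDiffAt.isSymmSndFDerivAt (by simp [← WithTop.coe_ofNat])
  have h1 : fderiv ℝ H = fun y => (symplecticForm d).flip (hamiltonianField H y) :=
    funext fun y => eq_hamiltonianField_iff.1 rfl
  have h2 := ((symplecticForm d).flip.hasFDerivAt.comp x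
    ((contDiff_hamiltonianField hH).differentiable (by simp) x).hasFDerivAt).fderiv
  have h3 := hs.eq ξ η
  rw [h1] at h3
  change fderiv ℝ (⇑(symplecticForm d).flip ∘ hamiltonianField H) x ξ η =
    fderiv ℝ (⇑(symplecticForm d).flip ∘ hamiltonianField H) x η ξ at h3
  rw [h2] at h3
  simp only [ContinuousLinearMap.comp_apply, ContinuousLinearMap.flip_apply] at h3
  rw [symplecticForm_swap, h3, neg_add_cancel]

/-- Invariance makes the dual 1-form `α` closed; on the whole space, which is convex, the Poincaré
lemma gives a global primitive. -/
theorem exists_eq_hamiltonianField {f : PhaseSpace d → PhaseSpace d} (hf : ContDiff ℝ ∞ f)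
    (h : IsInfinitesimallyInvariant (symplecticForm d) f) :
    ∃ H : PhaseSpace d → ℝ, ContDiff ℝ ∞ H ∧ f = hamiltonianField H := by
  let α : PhaseSpace d → PhaseSpace d →L[ℝ] ℝ := fun y => (symplecticForm d).flip (f y)
  have hα : ContDiff ℝ ∞ α := (symplecticForm d).flip.contDiff.comp hf
  have hα' : ∀ x, fderiv ℝ α x = (symplecticForm d).flip.comp (fderiv ℝ f x) := fun x =>
    ((symplecticForm d).flip.hasFDerivAt.comp x
      (hf.differentiable (by simp) x).hasFDerivAt).fderiv
  obtain ⟨H, hH⟩ := convex_univ.exists_forall_hasFDerivAt_of_fderiv_symmetric isOpen_univ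
    (hα.differentiable (by simp)).differentiableOn (fun x _ ξ η => by
      have h1 := h x ξ η
      rw [symplecticForm_swap] at h1
      simp only [hα', ContinuousLinearMap.comp_apply, ContinuousLinearMap.flip_apply]
      linarith)
  have hH' : ∀ x, HasFDerivAt H (α x) x := fun x => hH x (Set.mem_univ x)
  have e : fderiv ℝ H = α := funext fun x => (hH' x).fderiv
  refine ⟨H, contDiff_infty_iff_fderiv.2 ⟨fun x => (hH' x).differentiableAt, e ▸ hα⟩,
    funext fun y => eq_hamiltonianField_iff.2 (hH' y).fderiv⟩

theorem truncatedField_hamiltonianField {Hk : ℕ → PhaseSpace d → ℝ}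
    {fk : ℕ → PhaseSpace d → PhaseSpace d} {K : ℕ}
    (hH : ∀ k ≤ K, ContDiff ℝ ∞ (Hk k)) (hf : ∀ k ≤ K, fk k = hamiltonianField (Hk k)) (s : ℝ) :
    truncatedField fk K s =
      hamiltonianField (fun y => ∑ k ∈ Finset.range (K + 1), s ^ k * Hk k y) := by
  ext1 y
  rw [eq_hamiltonianField_iff]
  have h1 : HasFDerivAt (fun y => ∑ k ∈ Finset.range (K + 1), s ^ k * Hk k y)
      (∑ k ∈ Finset.range (K + 1), s ^ k • (symplecticForm d).flip (fk k y)) y := by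
    refine HasFDerivAt.fun_sum fun k hk => ?_
    have hk' : k ≤ K := Nat.lt_succ_iff.1 (Finset.mem_range.1 hk)
    rw [← eq_hamiltonianField_iff.1 (congrFun (hf k hk') y)]
    exact ((hH k hk').differentiable (by simp) y).hasFDerivAt.const_mul _
  rw [h1.fderiv, truncatedField, map_sum]
  simp only [map_smul]

theorem jacobianMatrix_mulVec (g : PhaseSpace d → PhaseSpace d) (x v : PhaseSpace d) :
    jacobianMatrix g x *ᵥ v.ofLp = (fderiv ℝ g x v).ofLp := by
  have h1 : jacobianMatrix g x = LinearMap.toMatrix (EuclideanSpace.basisFun _ ℝ).toBasis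
      (EuclideanSpace.basisFun _ ℝ).toBasis (fderiv ℝ g x).toLinearMap := by
    ext i j
    simp [jacobianMatrix, LinearMap.toMatrix_apply]
  have h2 := LinearMap.toMatrix_mulVec_repr (EuclideanSpace.basisFun _ ℝ).toBasis
    (EuclideanSpace.basisFun _ ℝ).toBasis (fderiv ℝ g x).toLinearMap v
  rw [← h1] at h2
  exact h2

theorem IsSymplecticOn.symplecticForm_fderiv {g : PhaseSpace d → PhaseSpace d}
    {U : Set (PhaseSpace d)} (hg : IsSymplecticOn g U) {x : PhaseSpace d} (hx : x ∈ U)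
    (ξ η : PhaseSpace d) :
    symplecticForm d (fderiv ℝ g x ξ) (fderiv ℝ g x η) = symplecticForm d ξ η := by
  rw [symplecticForm_apply, symplecticForm_apply, ← jacobianMatrix_mulVec, ← jacobianMatrix_mulVec,
    ← Matrix.vecMul_transpose, ← Matrix.dotProduct_mulVec, Matrix.mulVec_mulVec,
    Matrix.mulVec_mulVec, hg.2 x hx]

/-- The coefficients of the inverse modified equation of a symplectic integrator for a Hamiltonian
system are globally Hamiltonian. -/
theorem IsIMDE.exists_hamiltonian {Φ : Integrator (PhaseSpace d)} (hcons : Φ.IsConsistent)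
    (hsymp : Φ.IsSymplectic) {H : PhaseSpace d → ℝ} (hH : ContDiff ℝ ∞ H)
    {fk : ℕ → PhaseSpace d → PhaseSpace d} (himde : IsIMDE Φ (hamiltonianField H) fk) (k : ℕ) :
    ∃ Hk : PhaseSpace d → ℝ, ContDiff ℝ ∞ Hk ∧ fk k = hamiltonianField Hk := by
  have hf := contDiff_hamiltonianField hH
  induction k using Nat.strong_induction_on with
  | _ k ih =>
    obtain _ | K := k
    · exact ⟨H, hH, himde.coeff_zero hcons hf⟩
    choose! Hk hHk hfk using ih
    refine exists_eq_hamiltonianField (himde.smooth _) ?_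
    refine himde.isInfinitesimallyInvariant_succ hcons hf
      (isInfinitesimallyInvariant_hamiltonianField hH) K fun s x => ?_
    rw [truncatedField_hamiltonianField (fun k hk => hHk k (Nat.lt_succ_iff.2 hk))
      (fun k hk => hfk k (Nat.lt_succ_iff.2 hk))]
    -- Symplecticity is applied to one Hamiltonian with `s` frozen, since it concerns only
    -- `h`-independent vector fields.
    obtain ⟨U, -, hxU, hU⟩ := hsymp
      (fun y => ∑ k ∈ Finset.range (K + 1), s ^ k * Hk k y)
      (ContDiff.sum fun k hk => contDiff_const.mul (hHk k (Finset.mem_range.1 hk))) x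
    filter_upwards [hU] with h hh ξ η
    exact hh.symplecticForm_fderiv hxU ξ η

end PhaseSpace

theorem theorem5 (d : ℕ) (Φ : Integrator (PhaseSpace d)) (hcons : Φ.IsConsistent)
    (hsymp : Φ.IsSymplectic) (H : PhaseSpace d → ℝ) (hH : ContDiff ℝ ∞ H)
    (fk : ℕ → PhaseSpace d → PhaseSpace d) (himde : IsIMDE Φ (hamiltonianField H) fk) :
    ∀ x : PhaseSpace d, ∃ U : Set (PhaseSpace d), IsOpen U ∧ x ∈ U ∧
      ∃ Hk : ℕ → PhaseSpace d → ℝ, ∀ k : ℕ,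
        ContDiffOn ℝ ∞ (Hk k) U ∧ ∀ y ∈ U, fk k y = hamiltonianField (Hk k) y := by
  intro x
  choose Hk hHk hfk using himde.exists_hamiltonian hcons hsymp hH
  -- The Hamiltonians are global, so the whole space serves as the neighbourhood.
  exact ⟨Set.univ, isOpen_univ, Set.mem_univ x, Hk, fun k =>
    ⟨(hHk k).contDiffOn, fun y _ => congrFun (hfk k) y⟩⟩
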